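/- Let $q$ be a complex number with $0<|q|<1$. Fix $\tau\in\mathbb C$ with $e^{\tau}=q$ and put $q^{a}=e^{a\tau}$ for $a\in\mathbb C$. Write $(a;q)_n=\prod_{j=0}^{n-1}(1-q^ja)$, $(a;q)_\infty=\prod_{j\ge 0}(1-q^ja)$, $(a_1,\dots,a_N;q)_\infty=(a_1;q)_\infty\cdots(a_N;q)_\infty$, and $${}_3\phi_2\left({a_1,a_2,a_3\atop b_1,b_2};q,z\right)=\sum_{n\ge0}\frac{(a_1;q)_n(a_2;q)_n(a_3;q)_n}{(q;q)_n(b_1;q)_n(b_2;q)_n}z^n .$$ Let $h_1,h_2,l_1,l_2,k_1,k_2\in\mathbb C$, let $t_1,t_2\in\mathbb C\setminus\{0\}$, and set $\lambda=(h_1+h_2-l_1-l_2-k_1+k_2+1)/2$. Let $S\subseteq\mathbb C\setminus\{0\}$ be a set stable under multiplication by $q$ and $q^{-1}$, with a function $\ell:S\to\mathbb C$ such that $e^{\ell(x)}=x$ and $\ell(qx)=\ell(x)+\tau$ for $x\in S$, and put $x^{a}=e^{a\ell(x)}$ for $x\in S$ (a branch of the power function with $(qx)^a=q^ax^a$). Define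 on $S$ $$g_0(x)=x^{1-k_2}q^{-\lambda}\frac{(q^{-\lambda-l_1+3/2}x/t_1,\;q^{-\lambda-l_2+3/2}x/t_2,\;q;q)_\infty}{(q^{-h_1+1/2}x/t_1,\;q^{-h_2+1/2}x/t_2,\;q^{1-\lambda};q)_\infty}\;{}_3\phi_2\left({q^{-h_1+1/2}x/t_1,\;q^{-h_2+1/2}x/t_2,\;q^{1-\lambda}\atop q^{-\lambda-l_1+3/2}x/t_1,\;q^{-\lambda-l_2+3/2}x/t_2};q,q\right)$$ and, for $i\in\{1,2\}$ and $i'=3-i$, $$g_i(x)=x^{-k_2}q^{l_i-1/2}t_i\frac{(q^{\lambda+l_i+1/2}t_i/x,\;q^{l_i-l_{i'}+1}t_i/t_{i'},\;q;q)_\infty}{(q^{l_i+1/2}t_i/x,\;q^{\lambda-h_i+l_i},\;q^{\lambda-h_{i'}+l_i}t_i/t_{i'};q)_\infty}\;{}_3\phi_2\left({q^{l_i+1/2}t_i/x,\;q^{\lambda-h_i+l_i},\;q^{\lambda-h_{i'}+l_i}t_i/t_{i'}\atop q^{\lambda+l_i+1/2}t_i/x,\;q^{l_i-l_{i'}+1}t_i/t_{i'}};q,q\right).$$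 The expression $g_i(x)$ is meaningful at the points $x$ at which none of its denominators vanishes, that is, at which no argument of an infinite $q$-Pochhammer symbol in the denominator and no lower parameter of ${}_3\phi_2$ lies in $\{1,q^{-1},q^{-2},\dots\}$. Then for all $i,j\in\{0,1,2\}$ the function $g=g_i-g_j$ satisfies the variant of the $q$-hypergeometric equation of degree two $$\bigl(x-q^{h_1+1/2}t_1\bigr)\bigl(x-q^{h_2+1/2}t_2\bigr)g(x/q)+q^{k_1+k_2}\bigl(x-q^{l_1-1/2}t_1\bigr)\bigl(x-q^{l_2-1/2}t_2\bigr)g(qx)$$ $$-\bigl[(q^{k_1}+q^{k_2})x^2+Ex+p(q^{1/2}+q^{-1/2})t_1t_2\bigr]g(x)=0,$$ $$p=q^{(h_1+h_2+l_1+l_2+k_1+k_2)/2},\qquad E=-p\bigl\{(q^{-h_2}+q^{-l_2})t_1+(q^{-h_1}+q^{-l_1})t_2\bigr\},$$ at every $x\in S$ such that $g_i$ and $g_j$ are both meaningful at $x/q$, $x$ and $qx$. -/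

import Mathlib

open Filter Topology

namespace QHypergeometric

/-- The finite `q`-Pochhammer symbol `(a; q)_n = (1 - a)(1 - a q) ⋯ (1 - a q^(n-1))`. -/
noncomputable def qPoch (q a : ℂ) (n : ℕ) : ℂ := ∏ j ∈ Finset.range n, (1 - q ^ j * a)

/-- The infinite `q`-Pochhammer symbol `(a; q)_∞ = ∏_{j ≥ 0} (1 - q^j a)`. -/
noncomputable def qPochInf (q a : ℂ) : ℂ := ∏' j : ℕ, (1 - q ^ j * a)

/-- The infinite product is a genuine one when `|q| < 1`. -/
theorem multipliable_qPochInf {q : ℂ} (hq : ‖q‖ < 1) (a : ℂ) :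
    Multipliable fun j : ℕ => 1 - q ^ j * a := by
  have h : Summable fun j : ℕ => ‖-(q ^ j * a)‖ := by
    simp only [norm_neg, norm_mul, norm_pow]
    exact (summable_geometric_of_lt_one (norm_nonneg q) hq).mul_right _
  simpa [sub_eq_add_neg] using multipliable_one_add_of_summable h

/-- The general term of the basic hypergeometric series `₃φ₂`. -/
noncomputable def phiTerm (a₁ a₂ a₃ b₁ b₂ q z : ℂ) (n : ℕ) : ℂ :=
  qPoch q a₁ n * qPoch q a₂ n * qPoch q a₃ n
    / (qPoch q q n * qPoch q b₁ n * qPoch q b₂ n) * z ^ n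

/-- The basic hypergeometric series `₃φ₂(a₁, a₂, a₃; b₁, b₂; q, z)`. -/
noncomputable def phi32 (a₁ a₂ a₃ b₁ b₂ q z : ℂ) : ℂ := ∑' n : ℕ, phiTerm a₁ a₂ a₃ b₁ b₂ q z n

/-- The series `₃φ₂` converges absolutely when `|q| < 1` and `|z| < 1`. -/
theorem summable_phiTerm {q z : ℂ} (hq : ‖q‖ < 1) (hz : ‖z‖ < 1) (a₁ a₂ a₃ b₁ b₂ : ℂ) :
    Summable (phiTerm a₁ a₂ a₃ b₁ b₂ q z) := by
  have hl : ∀ c : ℂ, Tendsto (fun n : ℕ => 1 - q ^ n * c) atTop (𝓝 1) := fun c => by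
    simpa using ((tendsto_pow_atTop_nhds_zero_of_norm_lt_one hq).mul_const c).const_sub 1
  have hr : Tendsto (fun n : ℕ => (1 - q ^ n * a₁) * (1 - q ^ n * a₂) * (1 - q ^ n * a₃)
      / ((1 - q ^ n * q) * (1 - q ^ n * b₁) * (1 - q ^ n * b₂)) * z) atTop (𝓝 z) := by
    simpa using ((((hl a₁).mul (hl a₂)).mul (hl a₃)).div
      (((hl q).mul (hl b₁)).mul (hl b₂)) (by simp)).mul_const z
  obtain ⟨r, hzr, hr1⟩ := exists_between hz
  refine summable_of_ratio_norm_eventually_le hr1 ?_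
  filter_upwards [hr.norm.eventually_lt_const hzr] with n hn
  have : phiTerm a₁ a₂ a₃ b₁ b₂ q z (n + 1) =
      ((1 - q ^ n * a₁) * (1 - q ^ n * a₂) * (1 - q ^ n * a₃)
      / ((1 - q ^ n * q) * (1 - q ^ n * b₁) * (1 - q ^ n * b₂)) * z)
      * phiTerm a₁ a₂ a₃ b₁ b₂ q z n := by
    simp only [phiTerm, qPoch, Finset.prod_range_succ, pow_succ, div_eq_mul_inv, mul_inv]
    ring
  rw [this, norm_mul]
  exact mul_le_mul_of_nonneg_right hn.le (norm_nonneg _)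

/-- `a ∉ {1, q⁻¹, q⁻², …}`: none of the factors of `(a; q)_n` and `(a; q)_∞` vanishes, so that
these symbols may stand in a denominator. -/
def NonDegenerate (q a : ℂ) : Prop := ∀ n : ℕ, q ^ n * a ≠ 1

/-- The parameters of the variant of the `q`-hypergeometric equation of degree two, together with
a logarithm `τ` of `q`, which fixes the meaning of the powers `q ^ a`. -/
structure Param where
  τ : ℂ
  h₁ : ℂ
  h₂ : ℂ
  l₁ : ℂ
  l₂ : ℂ
  k₁ : ℂ
  k₂ : ℂ
  t₁ : ℂ
  t₂ : ℂ

namespace Param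

/-- The base `q = e^τ`. -/
noncomputable def q (P : Param) : ℂ := Complex.exp P.τ

/-- The power `q ^ a = e^(a τ)`. -/
noncomputable def qpow (P : Param) (a : ℂ) : ℂ := Complex.exp (a * P.τ)

/-- Interchange of the indices `1` and `2` of `h`, `l` and `t`. -/
def swap (P : Param) : Param where
  τ := P.τ
  h₁ := P.h₂
  h₂ := P.h₁
  l₁ := P.l₂
  l₂ := P.l₁
  k₁ := P.k₁
  k₂ := P.k₂
  t₁ := P.t₂
  t₂ := P.t₁

/-- `λ = (h₁ + h₂ - l₁ - l₂ - k₁ + k₂ + 1) / 2`. -/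
noncomputable def lam (P : Param) : ℂ := (P.h₁ + P.h₂ - P.l₁ - P.l₂ - P.k₁ + P.k₂ + 1) / 2

/-- `p = q ^ ((h₁ + h₂ + l₁ + l₂ + k₁ + k₂) / 2)`. -/
noncomputable def p (P : Param) : ℂ :=
  P.qpow ((P.h₁ + P.h₂ + P.l₁ + P.l₂ + P.k₁ + P.k₂) / 2)

/-- `E = -p {(q^(-h₂) + q^(-l₂)) t₁ + (q^(-h₁) + q^(-l₁)) t₂}`. -/
noncomputable def E (P : Param) : ℂ :=
  -P.p * ((P.qpow (-P.h₂) + P.qpow (-P.l₂)) * P.t₁ + (P.qpow (-P.h₁) + P.qpow (-P.l₁)) * P.t₂)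

/-- The function `g` satisfies the variant of the `q`-hypergeometric equation of degree two
at every point `x` such that `x / q`, `x` and `q x` lie in its domain `D`. -/
def IsSolutionOn (P : Param) (g : ℂ → ℂ) (D : Set ℂ) : Prop :=
  ∀ x : ℂ, x / P.q ∈ D → x ∈ D → P.q * x ∈ D →
    (x - P.qpow (P.h₁ + 1 / 2) * P.t₁) * (x - P.qpow (P.h₂ + 1 / 2) * P.t₂) * g (x / P.q)
      + P.qpow (P.k₁ + P.k₂) * (x - P.qpow (P.l₁ - 1 / 2) * P.t₁)
          * (x - P.qpow (P.l₂ - 1 / 2) * P.t₂) * g (P.q * x)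
      - ((P.qpow P.k₁ + P.qpow P.k₂) * x ^ 2 + P.E * x
          + P.p * (P.qpow (1 / 2) + P.qpow (-(1 / 2))) * P.t₁ * P.t₂) * g x = 0

/-- `ℓ` is a branch of the logarithm on the set `S ⊆ ℂ ∖ {0}`, which is stable under
multiplication by `q` and `q⁻¹`, compatible with the logarithm `τ` of `q`. The powers
`x ^ a = e^(a ℓ(x))` formed with it satisfy `(q x) ^ a = q ^ a x ^ a`. -/
structure IsLogBranch (P : Param) (S : Set ℂ) (ℓ : ℂ → ℂ) : Prop where
  mul_mem : ∀ x ∈ S, P.q * x ∈ S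
  div_mem : ∀ x ∈ S, x / P.q ∈ S
  exp_log : ∀ x ∈ S, Complex.exp (ℓ x) = x
  log_mul : ∀ x ∈ S, ℓ (P.q * x) = ℓ x + P.τ

/-- The function `g₀`. -/
noncomputable def gZero (P : Param) (ℓ : ℂ → ℂ) (x : ℂ) : ℂ :=
  Complex.exp ((1 - P.k₂) * ℓ x) * P.qpow (-P.lam)
    * (qPochInf P.q (P.qpow (-P.lam - P.l₁ + 3 / 2) * x / P.t₁)
        * qPochInf P.q (P.qpow (-P.lam - P.l₂ + 3 / 2) * x / P.t₂) * qPochInf P.q P.q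
      / (qPochInf P.q (P.qpow (-P.h₁ + 1 / 2) * x / P.t₁)
        * qPochInf P.q (P.qpow (-P.h₂ + 1 / 2) * x / P.t₂) * qPochInf P.q (P.qpow (1 - P.lam))))
    * phi32 (P.qpow (-P.h₁ + 1 / 2) * x / P.t₁) (P.qpow (-P.h₂ + 1 / 2) * x / P.t₂)
        (P.qpow (1 - P.lam))
        (P.qpow (-P.lam - P.l₁ + 3 / 2) * x / P.t₁) (P.qpow (-P.lam - P.l₂ + 3 / 2) * x / P.t₂)
        P.q P.q

/-- The points `x ≠ 0` at which no denominator in the expression of `g₀` vanishes. -/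
def regZero (P : Param) : Set ℂ :=
  {x | x ≠ 0 ∧ NonDegenerate P.q (P.qpow (-P.h₁ + 1 / 2) * x / P.t₁)
    ∧ NonDegenerate P.q (P.qpow (-P.h₂ + 1 / 2) * x / P.t₂)
    ∧ NonDegenerate P.q (P.qpow (1 - P.lam))
    ∧ NonDegenerate P.q (P.qpow (-P.lam - P.l₁ + 3 / 2) * x / P.t₁)
    ∧ NonDegenerate P.q (P.qpow (-P.lam - P.l₂ + 3 / 2) * x / P.t₂)}

/-- The function `g₁`. -/
noncomputable def gOne (P : Param) (ℓ : ℂ → ℂ) (x : ℂ) : ℂ :=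
  Complex.exp (-P.k₂ * ℓ x) * P.qpow (P.l₁ - 1 / 2) * P.t₁
    * (qPochInf P.q (P.qpow (P.lam + P.l₁ + 1 / 2) * P.t₁ / x)
        * qPochInf P.q (P.qpow (P.l₁ - P.l₂ + 1) * P.t₁ / P.t₂) * qPochInf P.q P.q
      / (qPochInf P.q (P.qpow (P.l₁ + 1 / 2) * P.t₁ / x)
        * qPochInf P.q (P.qpow (P.lam - P.h₁ + P.l₁))
        * qPochInf P.q (P.qpow (P.lam - P.h₂ + P.l₁) * P.t₁ / P.t₂)))
    * phi32 (P.qpow (P.l₁ + 1 / 2) * P.t₁ / x) (P.qpow (P.lam - P.h₁ + P.l₁))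
        (P.qpow (P.lam - P.h₂ + P.l₁) * P.t₁ / P.t₂)
        (P.qpow (P.lam + P.l₁ + 1 / 2) * P.t₁ / x) (P.qpow (P.l₁ - P.l₂ + 1) * P.t₁ / P.t₂)
        P.q P.q

/-- The points `x ≠ 0` at which no denominator in the expression of `g₁` vanishes. -/
def regOne (P : Param) : Set ℂ :=
  {x | x ≠ 0 ∧ NonDegenerate P.q (P.qpow (P.l₁ + 1 / 2) * P.t₁ / x)
    ∧ NonDegenerate P.q (P.qpow (P.lam - P.h₁ + P.l₁))
    ∧ NonDegenerate P.q (P.qpow (P.lam - P.h₂ + P.l₁) * P.t₁ / P.t₂)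
    ∧ NonDegenerate P.q (P.qpow (P.lam + P.l₁ + 1 / 2) * P.t₁ / x)
    ∧ NonDegenerate P.q (P.qpow (P.l₁ - P.l₂ + 1) * P.t₁ / P.t₂)}

/-- The functions `g₀`, `g₁`, `g₂`; `g₂` arises from `g₁` by interchanging the indices `1`, `2`. -/
noncomputable def g (P : Param) (ℓ : ℂ → ℂ) (i : Fin 3) : ℂ → ℂ :=
  ![P.gZero ℓ, P.gOne ℓ, P.swap.gOne ℓ] i

/-- The set of points at which the expression of `g_i` is meaningful. -/
def reg (P : Param) (i : Fin 3) : Set ℂ := ![P.regZero, P.regOne, P.swap.regOne] i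

end Param

end QHypergeometric

/-! Each $g_i$ is $x^{-k_2}q^{-1}$ times a Jackson-type sum of one and the same `kernel` over the
nodes $s=q^ns_0$, with $s_0=qx/q^\lambda$ for $g_0$ and $s_0=q/\alpha_i$ for $i=1,2$; the shifted
infinite products produce the ${}_3\phi_2$ series at $z=q$.

After removal of the power $x^{-k_2}$ and of a common constant, the operator of the equation, acting
in $x$, sends `kernel` to the $q$-difference in $s$ of `primitive` (`kernel_telescopes`). The sum
therefore telescopes to the limit of `primitive` as $s\to0$, which is $-qx(1-\Lambda)$ with
$\Lambda=q^\lambda$, minus a boundary term at $s_0$. That term vanishes at $q/\alpha_i$ because of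
the factor $(1;q)_\infty$. For $g_0$ the nodes move with $x$, and the terms lost in aligning the
three sums compensate it (`hasSum_kernel_diagonal`). So all three functions satisfy the same
inhomogeneous equation, and the right-hand side cancels in $g_i-g_j$. -/

namespace QHypergeometric

/-! ### Shifts and limits of infinite $q$-Pochhammer symbols -/

theorem qPochInf_eq_mul_shift {q : ℂ} (hq : ‖q‖ < 1) (a : ℂ) :
    qPochInf q a = (1 - a) * qPochInf q (q * a) := by
  have h : (fun j : ℕ => 1 - q ^ j * (q * a)) = fun j : ℕ => 1 - q ^ (j + 1) * a := by
    funext j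
    rw [pow_succ, mul_assoc]
  have hm := multipliable_qPochInf hq (q * a)
  rw [h] at hm
  have := tprod_eq_zero_mul' (f := fun j : ℕ => 1 - q ^ j * a) hm
  rw [pow_zero, one_mul] at this
  unfold qPochInf
  rw [h, this]

theorem qPochInf_eq_qPoch_mul {q : ℂ} (hq : ‖q‖ < 1) (a : ℂ) (n : ℕ) :
    qPochInf q a = qPoch q a n * qPochInf q (q ^ n * a) := by
  induction n with
  | zero => simp [qPoch]
  | succ n ih =>
    rw [ih, qPochInf_eq_mul_shift hq (q ^ n * a), qPoch, qPoch, Finset.prod_range_succ, pow_succ',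
      mul_assoc q, mul_assoc]

theorem qPochInf_one (q : ℂ) : qPochInf q 1 = 0 := by
  unfold qPochInf
  exact tprod_of_exists_eq_zero ⟨0, by simp⟩

theorem qPoch_ne_zero {q a : ℂ} (h : NonDegenerate q a) (n : ℕ) : qPoch q a n ≠ 0 :=
  Finset.prod_ne_zero_iff.2 fun j _ => sub_ne_zero.2 (h j).symm

theorem NonDegenerate.one_sub_ne_zero {q a : ℂ} (h : NonDegenerate q a) : 1 - a ≠ 0 :=
  sub_ne_zero.2 fun h' => h 0 (by simp [← h'])

theorem NonDegenerate.pow_mul {q a : ℂ} (h : NonDegenerate q a) (n : ℕ) :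
    NonDegenerate q (q ^ n * a) := fun m => by
  rw [← mul_assoc, ← pow_add]; exact h _

theorem nonDegenerate_self {q : ℂ} (hq : ‖q‖ < 1) : NonDegenerate q q := fun n h => by
  have := congrArg norm h
  rw [← pow_succ, norm_pow, norm_one] at this
  exact (pow_lt_one₀ (norm_nonneg q) hq n.succ_ne_zero).ne this

/-- With $0^{-1}=0$ only the split-off factor has to be nonzero, so the nonvanishing of an infinite
product is never needed. -/
theorem inv_qPochInf_shift {q : ℂ} (hq : ‖q‖ < 1) {a : ℂ} (ha : 1 - a ≠ 0) :
    (qPochInf q (q * a))⁻¹ = (1 - a) * (qPochInf q a)⁻¹ := by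
  rw [qPochInf_eq_mul_shift hq a, mul_inv, mul_inv_cancel_left₀ ha]

theorem tendsto_qPochInf {q : ℂ} (hq : ‖q‖ < 1) (a : ℂ) :
    Tendsto (fun n : ℕ => qPochInf q (q ^ n * a)) atTop (𝓝 1) := by
  have hs : ∀ b : ℂ, HasSum (fun j : ℕ => ‖-(q ^ j * b)‖) ((1 - ‖q‖)⁻¹ * ‖b‖) := fun b => by
    simp only [norm_neg, norm_mul, norm_pow]
    exact (hasSum_geometric_of_lt_one (norm_nonneg q) hq).mul_right _
  have hb : ∀ b : ℂ, ‖qPochInf q b - 1‖ ≤ Real.exp ((1 - ‖q‖)⁻¹ * ‖b‖) - 1 := fun b => by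
    refine le_of_tendsto ((multipliable_qPochInf hq b).hasProd.sub_const 1).norm
      (Eventually.of_forall fun t => ?_)
    -- The bound $|\prod(1+u_j)-1|\le e^{\sum|u_j|}-1$ for finite products passes to the limit; its
    -- right side tends to $0$ with $b$.
    have h := t.norm_prod_one_add_sub_one_le fun j : ℕ => -(q ^ j * b)
    simp only [← sub_eq_add_neg] at h
    exact h.trans (sub_le_sub_right (Real.exp_le_exp.2
      (sum_le_hasSum t (fun _ _ => norm_nonneg _) (hs b))) 1)
  rw [tendsto_iff_norm_sub_tendsto_zero]
  refine squeeze_zero (fun _ => norm_nonneg _) (fun n => hb _) ?_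
  have h0 : Tendsto (fun n : ℕ => q ^ n * a) atTop (𝓝 0) := by
    simpa using (tendsto_pow_atTop_nhds_zero_of_norm_lt_one hq).mul_const a
  have := (Real.continuous_exp.tendsto _).comp ((h0.norm).const_mul ((1 - ‖q‖)⁻¹))
  simpa using this.sub_const 1

/-- A `₃φ₂` series at `z = q`, with its infinite products, as a Jackson-type sum. -/
theorem hasSum_qPochInf_mul_phi32 {q : ℂ} (hq : ‖q‖ < 1) {a₁ a₂ a₃ b₁ b₂ : ℂ}
    (h₁ : NonDegenerate q a₁) (h₂ : NonDegenerate q a₂) (h₃ : NonDegenerate q a₃)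
    (hb₁ : NonDegenerate q b₁) (hb₂ : NonDegenerate q b₂) :
    HasSum (fun n : ℕ => q ^ n * (qPochInf q (q ^ n * b₁) * qPochInf q (q ^ n * b₂)
        * qPochInf q (q ^ n * q)
        / (qPochInf q (q ^ n * a₁) * qPochInf q (q ^ n * a₂) * qPochInf q (q ^ n * a₃))))
      (qPochInf q b₁ * qPochInf q b₂ * qPochInf q q
        / (qPochInf q a₁ * qPochInf q a₂ * qPochInf q a₃) * phi32 a₁ a₂ a₃ b₁ b₂ q q) := by
  refine ((summable_phiTerm hq hq a₁ a₂ a₃ b₁ b₂).hasSum.mul_left _).congr_fun fun n => ?_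
  have e := qPochInf_eq_qPoch_mul hq (n := n)
  rw [e a₁, e a₂, e a₃, e b₁, e b₂, e q, phiTerm]
  have := qPoch_ne_zero h₁ n
  have := qPoch_ne_zero h₂ n
  have := qPoch_ne_zero h₃ n
  have := qPoch_ne_zero hb₁ n
  have := qPoch_ne_zero hb₂ n
  have := qPoch_ne_zero (nonDegenerate_self hq) n
  simp only [div_eq_mul_inv, mul_inv]
  field_simp

/-! ### The kernel and its telescoping sums -/

/-- The summand of the Jackson integrals that represent the solutions. -/
noncomputable def kernel (q Λ α₁ α₂ β₁ β₂ s x : ℂ) : ℂ :=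
  s * (qPochInf q (α₁ * s) * qPochInf q (α₂ * s) * qPochInf q (Λ * s / x))
    * ((qPochInf q (β₁ * s))⁻¹ * (qPochInf q (β₂ * s))⁻¹ * (qPochInf q (s / x))⁻¹)

/-- A function whose `q`-difference is the image of `kernel` under the `q`-difference operator. -/
noncomputable def primitive (q Λ α₁ α₂ β₁ β₂ s x : ℂ) : ℂ :=
  -(q * x * (1 - Λ))
    * (qPochInf q (α₁ * (s / q)) * qPochInf q (α₂ * (s / q)) * qPochInf q (Λ * s / x))
    * ((qPochInf q (β₁ * s))⁻¹ * (qPochInf q (β₂ * s))⁻¹ * (qPochInf q (s / (q * x)))⁻¹)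

/-- The normalized coefficient of `g (x / q)`. -/
def coeffDiv (q Λ β₁ β₂ x : ℂ) : ℂ := q * ((Λ - β₁ * x) * (Λ - β₂ * x))

/-- The normalized coefficient of `g (q x)`. -/
def coeffMul (α₁ α₂ x : ℂ) : ℂ := (1 - α₁ * x) * (1 - α₂ * x)

/-- The normalized coefficient of `g x`. -/
def coeffMid (q Λ α₁ α₂ β₁ β₂ x : ℂ) : ℂ :=
  (α₁ * α₂ + q * (β₁ * β₂)) * x ^ 2 - (q * (β₁ + β₂) + Λ * (α₁ + α₂)) * x + Λ * (1 + q)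

/-- All five terms are rational multiples of one product of infinite symbols. Once it is divided
out, a rational identity (`key`) remains. -/
theorem kernel_telescopes {q : ℂ} (hq : ‖q‖ < 1) (hq0 : q ≠ 0) {Λ α₁ α₂ β₁ β₂ s x : ℂ}
    (hx : x ≠ 0) (h₁ : 1 - β₁ * s ≠ 0) (h₂ : 1 - β₂ * s ≠ 0)
    (h₃ : 1 - s / (q * x) ≠ 0) (h₄ : 1 - s / x ≠ 0) :
    coeffDiv q Λ β₁ β₂ x * kernel q Λ α₁ α₂ β₁ β₂ s (x / q)
      + coeffMul α₁ α₂ x * kernel q Λ α₁ α₂ β₁ β₂ s (q * x)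
      - coeffMid q Λ α₁ α₂ β₁ β₂ x * kernel q Λ α₁ α₂ β₁ β₂ s x
    = primitive q Λ α₁ α₂ β₁ β₂ (q * s) x - primitive q Λ α₁ α₂ β₁ β₂ s x := by
  have e₁ : (qPochInf q (s / x))⁻¹ = (1 - s / (q * x)) * (qPochInf q (s / (q * x)))⁻¹ := by
    rw [← inv_qPochInf_shift hq h₃]; congr 2; field_simp
  have e₂ : (qPochInf q (s / (x / q)))⁻¹ = (1 - s / x) * (qPochInf q (s / x))⁻¹ := by
    rw [← inv_qPochInf_shift hq h₄]; congr 2; field_simp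
  have e₃ : (qPochInf q (q * s / (q * x)))⁻¹ = (qPochInf q (s / x))⁻¹ := by
    congr 2; field_simp
  have e₄ : qPochInf q (Λ * s / x) = (1 - Λ * s / x) * qPochInf q (Λ * s / (x / q)) := by
    rw [qPochInf_eq_mul_shift hq (Λ * s / x)]; congr 2; field_simp
  have e₅ : qPochInf q (Λ * s / (q * x)) = (1 - Λ * s / (q * x)) * qPochInf q (Λ * s / x) := by
    rw [qPochInf_eq_mul_shift hq (Λ * s / (q * x))]; congr 2; field_simp
  have e₆ : qPochInf q (Λ * (q * s) / x) = qPochInf q (Λ * s / (x / q)) := by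
    congr 1; field_simp
  have e₇ : ∀ α, qPochInf q (α * (s / q)) = (1 - α * (s / q)) * qPochInf q (α * s) := fun α => by
    rw [qPochInf_eq_mul_shift hq]; congr 2; field_simp
  have e₈ : ∀ β, 1 - β * s ≠ 0 →
      (qPochInf q (β * (q * s)))⁻¹ = (1 - β * s) * (qPochInf q (β * s))⁻¹ := fun β hβ => by
    rw [← inv_qPochInf_shift hq hβ]; congr 2; ring
  have e₉ : ∀ α, qPochInf q (α * (q * s / q)) = qPochInf q (α * s) := fun α => by
    rw [mul_div_cancel_left₀ _ hq0]
  unfold kernel primitive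
  rw [e₈ _ h₁, e₈ _ h₂, e₉, e₉, e₇, e₇, e₃, e₂, e₁, e₆, e₅, e₄]
  generalize (qPochInf q (s / (q * x)))⁻¹ = Z₁
  generalize (qPochInf q (β₁ * s))⁻¹ = Z₂
  generalize (qPochInf q (β₂ * s))⁻¹ = Z₃
  generalize qPochInf q (α₁ * s) = Z₄
  generalize qPochInf q (α₂ * s) = Z₅
  generalize qPochInf q (Λ * s / (x / q)) = Z₆
  have key : s * (coeffDiv q Λ β₁ β₂ x * ((1 - s / (q * x)) * (1 - s / x))
        + coeffMul α₁ α₂ x * ((1 - Λ * s / (q * x)) * (1 - Λ * s / x))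
        - coeffMid q Λ α₁ α₂ β₁ β₂ x * ((1 - s / (q * x)) * (1 - Λ * s / x)))
      = -(q * x * (1 - Λ)) * ((1 - β₁ * s) * (1 - β₂ * s) * (1 - s / (q * x))
        - (1 - α₁ * (s / q)) * (1 - α₂ * (s / q)) * (1 - Λ * s / x)) := by
    unfold coeffDiv coeffMul coeffMid
    field_simp
    ring
  linear_combination Z₁ * Z₂ * Z₃ * Z₄ * Z₅ * Z₆ * key

theorem tendsto_primitive {q : ℂ} (hq : ‖q‖ < 1) (Λ α₁ α₂ β₁ β₂ s x : ℂ) :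
    Tendsto (fun n : ℕ => primitive q Λ α₁ α₂ β₁ β₂ (q ^ n * s) x) atTop
      (𝓝 (-(q * x * (1 - Λ)))) := by
  have h : ∀ c : ℂ, Tendsto (fun n : ℕ => qPochInf q (q ^ n * c)) atTop (𝓝 1) :=
    tendsto_qPochInf hq
  have := ((((h (α₁ * (s / q))).mul (h (α₂ * (s / q)))).mul (h (Λ * s / x))).const_mul
    (-(q * x * (1 - Λ)))).mul ((((h (β₁ * s)).inv₀ one_ne_zero).mul
    ((h (β₂ * s)).inv₀ one_ne_zero)).mul ((h (s / (q * x))).inv₀ one_ne_zero))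
  simp only [mul_one, inv_one] at this
  refine this.congr fun n => ?_
  unfold primitive
  congr! 4 <;> ring_nf

theorem hasSum_kernel_telescopes {q : ℂ} (hq : ‖q‖ < 1) (hq0 : q ≠ 0)
    {Λ α₁ α₂ β₁ β₂ s x F₁ F₂ F₃ : ℂ} (hx : x ≠ 0)
    (h₁ : NonDegenerate q (β₁ * s)) (h₂ : NonDegenerate q (β₂ * s))
    (h₃ : NonDegenerate q (s / (q * x)))
    (hF₁ : HasSum (fun n : ℕ => kernel q Λ α₁ α₂ β₁ β₂ (q ^ n * s) (x / q)) F₁)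
    (hF₂ : HasSum (fun n : ℕ => kernel q Λ α₁ α₂ β₁ β₂ (q ^ n * s) (q * x)) F₂)
    (hF₃ : HasSum (fun n : ℕ => kernel q Λ α₁ α₂ β₁ β₂ (q ^ n * s) x) F₃) :
    coeffDiv q Λ β₁ β₂ x * F₁ + coeffMul α₁ α₂ x * F₂ - coeffMid q Λ α₁ α₂ β₁ β₂ x * F₃
      = -(q * x * (1 - Λ)) - primitive q Λ α₁ α₂ β₁ β₂ s x := by
  have hs := (((hF₁.mul_left (coeffDiv q Λ β₁ β₂ x)).add
    (hF₂.mul_left (coeffMul α₁ α₂ x))).sub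
    (hF₃.mul_left (coeffMid q Λ α₁ α₂ β₁ β₂ x))).tendsto_sum_nat
  have ht := (tendsto_primitive hq Λ α₁ α₂ β₁ β₂ s x).sub_const
    (primitive q Λ α₁ α₂ β₁ β₂ s x)
  refine tendsto_nhds_unique hs (ht.congr fun n => ?_)
  have hn : ∀ c : ℂ, NonDegenerate q c → ∀ n : ℕ, 1 - q ^ n * c ≠ 0 := fun c hc n =>
    (hc.pow_mul n).one_sub_ne_zero
  rw [Finset.sum_congr rfl fun n _ => kernel_telescopes hq hq0 hx ?_ ?_ ?_ ?_]
  · simp only [← mul_assoc, ← pow_succ']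
    rw [Finset.sum_range_sub (fun n => primitive q Λ α₁ α₂ β₁ β₂ (q ^ n * s) x)]
    simp
  · convert hn _ h₁ n using 1; ring
  · convert hn _ h₂ n using 1; ring
  · convert hn _ h₃ n using 1; ring
  -- Since $s/x=q\cdot s/(qx)$, this factor is the next one of the same symbol.
  · convert hn _ h₃ (n + 1) using 1; field_simp; ring

/-- The sum started at `q / α₁`, where the primitive vanishes. -/
theorem hasSum_kernel_root {q : ℂ} (hq : ‖q‖ < 1) (hq0 : q ≠ 0)
    {Λ α₁ α₂ β₁ β₂ x F₁ F₂ F₃ : ℂ} (hx : x ≠ 0) (hα : α₁ ≠ 0)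
    (h₁ : NonDegenerate q (β₁ * (q / α₁))) (h₂ : NonDegenerate q (β₂ * (q / α₁)))
    (h₃ : NonDegenerate q (q / α₁ / (q * x)))
    (hF₁ : HasSum (fun n : ℕ => kernel q Λ α₁ α₂ β₁ β₂ (q ^ n * (q / α₁)) (x / q)) F₁)
    (hF₂ : HasSum (fun n : ℕ => kernel q Λ α₁ α₂ β₁ β₂ (q ^ n * (q / α₁)) (q * x)) F₂)
    (hF₃ : HasSum (fun n : ℕ => kernel q Λ α₁ α₂ β₁ β₂ (q ^ n * (q / α₁)) x) F₃) :
    coeffDiv q Λ β₁ β₂ x * F₁ + coeffMul α₁ α₂ x * F₂ - coeffMid q Λ α₁ α₂ β₁ β₂ x * F₃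
      = -(q * x * (1 - Λ)) := by
  rw [hasSum_kernel_telescopes hq hq0 hx h₁ h₂ h₃ hF₁ hF₂ hF₃, primitive]
  have : α₁ * (q / α₁ / q) = 1 := by field_simp
  simp [this, qPochInf_one]

/-- The sum started at `q x / Λ`. -/
theorem hasSum_kernel_diagonal {q : ℂ} (hq : ‖q‖ < 1) (hq0 : q ≠ 0)
    {Λ α₁ α₂ β₁ β₂ x F₁ F₂ F₃ : ℂ} (hx : x ≠ 0) (hΛ : Λ ≠ 0)
    (h₁ : NonDegenerate q (β₁ * (x / Λ))) (h₂ : NonDegenerate q (β₂ * (x / Λ)))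
    (h₃ : NonDegenerate q (q / Λ))
    (hF₁ : HasSum (fun n : ℕ => kernel q Λ α₁ α₂ β₁ β₂ (q ^ n * (q * (x / q) / Λ)) (x / q)) F₁)
    (hF₂ : HasSum (fun n : ℕ => kernel q Λ α₁ α₂ β₁ β₂ (q ^ n * (q * (q * x) / Λ)) (q * x)) F₂)
    (hF₃ : HasSum (fun n : ℕ => kernel q Λ α₁ α₂ β₁ β₂ (q ^ n * (q * x / Λ)) x) F₃) :
    coeffDiv q Λ β₁ β₂ x * F₁ + coeffMul α₁ α₂ x * F₂ - coeffMid q Λ α₁ α₂ β₁ β₂ x * F₃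
      = -(q * x * (1 - Λ)) := by
  -- In terms of $y=x/\Lambda$ the sums at $x/q$, $x$, $qx$ start at $y$, $qy$, $q^2y$.
  obtain ⟨y, rfl⟩ : ∃ y, x = Λ * y := ⟨x / Λ, by field_simp⟩
  have hy : y ≠ 0 := right_ne_zero_of_mul hx
  rw [mul_div_cancel_left₀ _ hΛ] at h₁ h₂
  have d₁ : q * (Λ * y / q) / Λ = y := by field_simp
  have d₂ : q * (q * (Λ * y)) / Λ = q * q * y := by field_simp
  have d₃ : q * (Λ * y) / Λ = q * y := by field_simp
  rw [d₁] at hF₁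
  rw [d₂] at hF₂
  rw [d₃] at hF₃
  -- The sums are aligned at the latest start $q^2y$. Aligning at $y$ would make the boundary term
  -- vanish outright, but would require $1/(q\Lambda)$ to be nondegenerate, whereas only $q/\Lambda$
  -- is known to be.
  have hF₁' := (hasSum_nat_add_iff' 2).2 hF₁
  have hF₃' := (hasSum_nat_add_iff' 1).2 hF₃
  simp only [Finset.sum_range_succ, Finset.sum_range_zero, zero_add, pow_zero, one_mul,
    pow_succ, mul_assoc] at hF₁' hF₃'
  simp only [← mul_assoc q q y] at hF₁' hF₃'
  have e₀ : q * q * y / (q * (Λ * y)) = q / Λ := by field_simp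
  have hs := hasSum_kernel_telescopes hq hq0 hx
    (by convert h₁.pow_mul 2 using 1; ring) (by convert h₂.pow_mul 2 using 1; ring)
    (by rwa [e₀]) hF₁' hF₂ hF₃'
  -- The two terms dropped at $x/q$ and the one dropped at $x$ together equal the boundary term at
  -- $q^2y$.
  suffices hp : coeffDiv q Λ β₁ β₂ (Λ * y) * (kernel q Λ α₁ α₂ β₁ β₂ y (Λ * y / q)
        + kernel q Λ α₁ α₂ β₁ β₂ (q * y) (Λ * y / q))
      - coeffMid q Λ α₁ α₂ β₁ β₂ (Λ * y) * kernel q Λ α₁ α₂ β₁ β₂ (q * y) (Λ * y)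
      = primitive q Λ α₁ α₂ β₁ β₂ (q * q * y) (Λ * y) by
    linear_combination hs + hp
  have i₁ : Λ * y / (Λ * y / q) = q := by field_simp
  have i₂ : Λ * (q * y) / (Λ * y / q) = q * q := by field_simp
  have i₃ : Λ * (q * y) / (Λ * y) = q := by field_simp
  have i₄ : Λ * (q * q * y) / (Λ * y) = q * q := by field_simp
  have j₁ : y / (Λ * y / q) = q / Λ := by field_simp
  have j₂ : q * y / (Λ * y / q) = q * (q / Λ) := by field_simp
  have j₃ : q * y / (Λ * y) = q / Λ := by field_simp
  have a₁ : ∀ α, α * (q * q * y / q) = α * (q * y) := fun α => by field_simp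
  have a₂ : ∀ α, qPochInf q (α * y) = (1 - α * y) * qPochInf q (α * (q * y)) := fun α => by
    rw [qPochInf_eq_mul_shift hq, mul_left_comm]
  have b₁ : ∀ β, NonDegenerate q (β * y) →
      (qPochInf q (β * (q * y)))⁻¹ = (1 - β * y) * (qPochInf q (β * y))⁻¹ := fun β hβ => by
    rw [← inv_qPochInf_shift hq hβ.one_sub_ne_zero, mul_left_comm]
  have b₂ : ∀ β, NonDegenerate q (β * y) → (qPochInf q (β * (q * q * y)))⁻¹
      = (1 - β * (q * y)) * ((1 - β * y) * (qPochInf q (β * y))⁻¹) := fun β hβ => by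
    have : 1 - β * (q * y) ≠ 0 := by
      convert (hβ.pow_mul 1).one_sub_ne_zero using 1; ring
    rw [← b₁ β hβ, ← inv_qPochInf_shift hq this]; congr 2; ring
  unfold kernel primitive
  rw [i₁, i₂, i₃, i₄, j₁, j₂, j₃, e₀, a₁, a₁, b₁ _ h₁, b₁ _ h₂, b₂ _ h₁, b₂ _ h₂,
    a₂ α₁, a₂ α₂, qPochInf_eq_mul_shift hq q, inv_qPochInf_shift hq h₃.one_sub_ne_zero]
  have key : coeffDiv q Λ β₁ β₂ (Λ * y) * (y * ((1 - α₁ * y) * (1 - α₂ * y) * (1 - q))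
        + q * y * ((1 - β₁ * y) * (1 - β₂ * y) * (1 - q / Λ)))
      - coeffMid q Λ α₁ α₂ β₁ β₂ (Λ * y) * (q * y * ((1 - β₁ * y) * (1 - β₂ * y) * (1 - q)))
      = -(q * (Λ * y) * (1 - Λ)) * ((1 - β₁ * y) * (1 - β₂ * y) * (1 - β₁ * (q * y))
        * (1 - β₂ * (q * y))) := by
    unfold coeffDiv coeffMid
    field_simp
    ring
  linear_combination (qPochInf q (α₁ * (q * y)) * qPochInf q (α₂ * (q * y)) * qPochInf q (q * q)
    * ((qPochInf q (β₁ * y))⁻¹ * (qPochInf q (β₂ * y))⁻¹ * (qPochInf q (q / Λ))⁻¹)) * key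

/-! ### The ${}_3\phi_2$ series as sums of the kernel -/

theorem hasSum_kernel_of_ne {q : ℂ} (hq : ‖q‖ < 1) {Λ α₁ α₂ β₁ β₂ x : ℂ} (hx : x ≠ 0)
    (hΛ : Λ ≠ 0) (h₁ : NonDegenerate q (β₁ * (q * x / Λ)))
    (h₂ : NonDegenerate q (β₂ * (q * x / Λ))) (h₃ : NonDegenerate q (q / Λ))
    (h₄ : NonDegenerate q (α₁ * (q * x / Λ))) (h₅ : NonDegenerate q (α₂ * (q * x / Λ))) :
    HasSum (fun n : ℕ => kernel q Λ α₁ α₂ β₁ β₂ (q ^ n * (q * x / Λ)) x)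
      (q * x / Λ * (qPochInf q (α₁ * (q * x / Λ)) * qPochInf q (α₂ * (q * x / Λ)) * qPochInf q q
        / (qPochInf q (β₁ * (q * x / Λ)) * qPochInf q (β₂ * (q * x / Λ)) * qPochInf q (q / Λ))
        * phi32 (β₁ * (q * x / Λ)) (β₂ * (q * x / Λ)) (q / Λ) (α₁ * (q * x / Λ))
          (α₂ * (q * x / Λ)) q q)) := by
  refine ((hasSum_qPochInf_mul_phi32 hq h₁ h₂ h₃ h₄ h₅).mul_left (q * x / Λ)).congr_fun
    fun n => ?_
  have e₁ : Λ * (q ^ n * (q * x / Λ)) / x = q ^ n * q := by field_simp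
  have e₂ : q ^ n * (q * x / Λ) / x = q ^ n * (q / Λ) := by field_simp
  have e : ∀ c, c * (q ^ n * (q * x / Λ)) = q ^ n * (c * (q * x / Λ)) := fun c => mul_left_comm _ _ _
  rw [kernel, e₁, e₂, e, e, e, e]
  simp only [div_eq_mul_inv, mul_inv]
  ring

theorem hasSum_kernel_of_root {q : ℂ} (hq : ‖q‖ < 1) {Λ α₁ α₂ β₁ β₂ x : ℂ} (hα : α₁ ≠ 0)
    (h₁ : NonDegenerate q (q / α₁ / x)) (h₂ : NonDegenerate q (β₁ * (q / α₁)))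
    (h₃ : NonDegenerate q (β₂ * (q / α₁))) (h₄ : NonDegenerate q (Λ * (q / α₁) / x))
    (h₅ : NonDegenerate q (α₂ * (q / α₁))) :
    HasSum (fun n : ℕ => kernel q Λ α₁ α₂ β₁ β₂ (q ^ n * (q / α₁)) x)
      (q / α₁ * (qPochInf q (Λ * (q / α₁) / x) * qPochInf q (α₂ * (q / α₁)) * qPochInf q q
        / (qPochInf q (q / α₁ / x) * qPochInf q (β₁ * (q / α₁)) * qPochInf q (β₂ * (q / α₁)))
        * phi32 (q / α₁ / x) (β₁ * (q / α₁)) (β₂ * (q / α₁)) (Λ * (q / α₁) / x)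
          (α₂ * (q / α₁)) q q)) := by
  refine ((hasSum_qPochInf_mul_phi32 hq h₁ h₂ h₃ h₄ h₅).mul_left (q / α₁)).congr_fun
    fun n => ?_
  have e₁ : Λ * (q ^ n * (q / α₁)) / x = q ^ n * (Λ * (q / α₁) / x) := by ring
  have e₂ : q ^ n * (q / α₁) / x = q ^ n * (q / α₁ / x) := by ring
  have e₃ : α₁ * (q ^ n * (q / α₁)) = q ^ n * q := by field_simp
  have e : ∀ c, c * (q ^ n * (q / α₁)) = q ^ n * (c * (q / α₁)) := fun c => mul_left_comm _ _ _
  rw [kernel, e₁, e₂, e₃, e, e, e]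
  simp only [div_eq_mul_inv, mul_inv]
  ring

/-! ### Translation to the parameters of the equation -/

namespace Param

variable (P : Param)

theorem qpow_add (a b : ℂ) : P.qpow (a + b) = P.qpow a * P.qpow b := by
  rw [qpow, add_mul, Complex.exp_add, qpow, qpow]

theorem qpow_sub (a b : ℂ) : P.qpow (a - b) = P.qpow a / P.qpow b := by
  rw [qpow, sub_mul, Complex.exp_sub, qpow, qpow]

theorem qpow_neg (a : ℂ) : P.qpow (-a) = (P.qpow a)⁻¹ := by
  rw [qpow, neg_mul, Complex.exp_neg, qpow]

theorem qpow_ne_zero (a : ℂ) : P.qpow a ≠ 0 := Complex.exp_ne_zero _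

theorem q_ne_zero : P.q ≠ 0 := Complex.exp_ne_zero _

theorem q_eq_sq : P.q = P.qpow (1 / 2) ^ 2 := by
  rw [sq, ← qpow_add, qpow, q]; norm_num

theorem qpow_one : P.qpow 1 = P.q := by rw [qpow, one_mul, q]

theorem qpow_three_halves : P.qpow (3 / 2) = P.qpow (1 / 2) ^ 3 := by
  rw [pow_succ, sq, ← qpow_add, ← qpow_add]; norm_num

/-- The left-hand side of the variant of the `q`-hypergeometric equation of degree two. -/
noncomputable def operator (g : ℂ → ℂ) (x : ℂ) : ℂ :=
  (x - P.qpow (P.h₁ + 1 / 2) * P.t₁) * (x - P.qpow (P.h₂ + 1 / 2) * P.t₂) * g (x / P.q)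
      + P.qpow (P.k₁ + P.k₂) * (x - P.qpow (P.l₁ - 1 / 2) * P.t₁)
          * (x - P.qpow (P.l₂ - 1 / 2) * P.t₂) * g (P.q * x)
      - ((P.qpow P.k₁ + P.qpow P.k₂) * x ^ 2 + P.E * x
          + P.p * (P.qpow (1 / 2) + P.qpow (-(1 / 2))) * P.t₁ * P.t₂) * g x

/-- The common value of `operator` at the functions `g₀`, `g₁`, `g₂`. -/
noncomputable def inhomogeneity (ℓ : ℂ → ℂ) (x : ℂ) : ℂ :=
  -(Complex.exp (-P.k₂ * ℓ x) * P.qpow P.k₁ * (P.qpow P.l₁ * P.qpow P.l₂ * P.t₁ * P.t₂) / P.q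
    * (x * (1 - P.qpow P.lam)))

/-- The reciprocal `α₁` of the root of the coefficient of `g (q x)` which belongs to `t₁`. -/
noncomputable def α (l t : ℂ) : ℂ := P.qpow (1 / 2) / (P.qpow l * t)

/-- The parameter `β` such that `q ^ λ / β` is a root of the coefficient of `g (x / q)`. -/
noncomputable def β (h t : ℂ) : ℂ := P.qpow P.lam / (P.qpow h * P.qpow (1 / 2) * t)

/-- Together with `qpow_k₂` this eliminates the half-sum exponents: the coefficients become rational
in $q^{1/2}$, $q^\lambda$, $q^{k_1}$, $q^{l_i}$, $q^{h_i}$, $t_i$, which can then be treated as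
independent. -/
theorem p_eq : P.p = P.qpow P.lam * P.qpow P.k₁ * P.qpow P.l₁ * P.qpow P.l₂ / P.qpow (1 / 2) := by
  simp only [p, ← qpow_add, ← qpow_sub, lam]
  congr 1; ring

theorem qpow_k₂ : P.qpow P.k₂ = P.qpow P.lam ^ 2 * P.qpow P.l₁ * P.qpow P.l₂ * P.qpow P.k₁
    / (P.qpow P.h₁ * P.qpow P.h₂ * P.qpow (1 / 2) ^ 2) := by
  simp only [sq, ← qpow_add, ← qpow_sub, lam]
  congr 1; ring

theorem operator_eq_inhomogeneity (ht₁ : P.t₁ ≠ 0) (ht₂ : P.t₂ ≠ 0) {S : Set ℂ} {ℓ : ℂ → ℂ}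
    (hℓ : P.IsLogBranch S ℓ) {x : ℂ} (hx : x ∈ S) {g : ℂ → ℂ} {F₁ F₂ F₃ : ℂ}
    (h₁ : g (x / P.q) = Complex.exp (-P.k₂ * ℓ (x / P.q)) * (P.q⁻¹ * F₁))
    (h₂ : g (P.q * x) = Complex.exp (-P.k₂ * ℓ (P.q * x)) * (P.q⁻¹ * F₂))
    (h₃ : g x = Complex.exp (-P.k₂ * ℓ x) * (P.q⁻¹ * F₃))
    (hF : coeffDiv P.q (P.qpow P.lam) (P.β P.h₁ P.t₁) (P.β P.h₂ P.t₂) x * F₁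
      + coeffMul (P.α P.l₁ P.t₁) (P.α P.l₂ P.t₂) x * F₂
      - coeffMid P.q (P.qpow P.lam) (P.α P.l₁ P.t₁) (P.α P.l₂ P.t₂) (P.β P.h₁ P.t₁)
        (P.β P.h₂ P.t₂) x * F₃ = -(P.q * x * (1 - P.qpow P.lam))) :
    P.operator g x = P.inhomogeneity ℓ x := by
  have e₁ : Complex.exp (-P.k₂ * ℓ (x / P.q)) = P.qpow P.k₂ * Complex.exp (-P.k₂ * ℓ x) := by
    have := hℓ.log_mul _ (hℓ.div_mem x hx)
    rw [mul_div_cancel₀ _ P.q_ne_zero] at this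
    rw [this, qpow, ← Complex.exp_add]; congr 1; ring
  have e₂ : Complex.exp (-P.k₂ * ℓ (P.q * x)) = Complex.exp (-P.k₂ * ℓ x) / P.qpow P.k₂ := by
    rw [hℓ.log_mul x hx, qpow, ← Complex.exp_sub]; congr 1; ring
  rw [e₁] at h₁
  rw [e₂] at h₂
  have hr := P.qpow_ne_zero (1 / 2)
  have hH₁ := P.qpow_ne_zero P.h₁
  have hH₂ := P.qpow_ne_zero P.h₂
  have hL₁ := P.qpow_ne_zero P.l₁
  have hL₂ := P.qpow_ne_zero P.l₂
  have hK₁ := P.qpow_ne_zero P.k₁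
  have hΛ := P.qpow_ne_zero P.lam
  have hK₂ := P.qpow_k₂
  have hp := P.p_eq
  have hE : P.E = -P.p * (((P.qpow P.h₂)⁻¹ + (P.qpow P.l₂)⁻¹) * P.t₁
      + ((P.qpow P.h₁)⁻¹ + (P.qpow P.l₁)⁻¹) * P.t₂) := by
    simp only [E, qpow_neg]
  rw [hp] at hE
  rw [operator, inhomogeneity, h₁, h₂, h₃, hE, hp]
  simp only [qpow_add, qpow_sub, qpow_neg, q_eq_sq, α, β] at hF ⊢
  rw [hK₂]
  generalize P.qpow P.k₁ = K at *
  generalize P.qpow P.l₁ = L₁ at *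
  generalize P.qpow P.l₂ = L₂ at *
  generalize P.qpow P.h₁ = H₁ at *
  generalize P.qpow P.h₂ = H₂ at *
  generalize P.qpow P.lam = Λ at *
  generalize P.qpow (1 / 2) = r at *
  generalize P.t₁ = t₁ at *
  generalize P.t₂ = t₂ at *
  generalize Complex.exp (-P.k₂ * ℓ x) = X
  -- The shifts of $x^{-k_2}$ multiply the coefficient of $g(x/q)$ by $q^{k_2}$ and that of $g(qx)$
  -- by $q^{-k_2}$. All three coefficients then share the factor $q^{k_1+l_1+l_2-1}t_1t_2$.
  have a₁ : (x - H₁ * r * t₁) * (x - H₂ * r * t₂) * (Λ ^ 2 * L₁ * L₂ * K / (H₁ * H₂ * r ^ 2))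
      = K * (L₁ * L₂ * t₁ * t₂ / r ^ 2)
        * coeffDiv (r ^ 2) Λ (Λ / (H₁ * r * t₁)) (Λ / (H₂ * r * t₂)) x := by
    unfold coeffDiv; field_simp; ring
  have a₂ : K * (x - L₁ / r * t₁) * (x - L₂ / r * t₂) = K * (L₁ * L₂ * t₁ * t₂ / r ^ 2)
        * coeffMul (r / (L₁ * t₁)) (r / (L₂ * t₂)) x := by
    unfold coeffMul; field_simp; ring
  have a₃ : (K + Λ ^ 2 * L₁ * L₂ * K / (H₁ * H₂ * r ^ 2)) * x ^ 2
      + -(Λ * K * L₁ * L₂ / r) * ((H₂⁻¹ + L₂⁻¹) * t₁ + (H₁⁻¹ + L₁⁻¹) * t₂) * x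
      + Λ * K * L₁ * L₂ / r * (r + r⁻¹) * t₁ * t₂ = K * (L₁ * L₂ * t₁ * t₂ / r ^ 2)
        * coeffMid (r ^ 2) Λ (r / (L₁ * t₁)) (r / (L₂ * t₂)) (Λ / (H₁ * r * t₁))
          (Λ / (H₂ * r * t₂)) x := by
    unfold coeffMid; field_simp; ring
  have hM : Λ ^ 2 * L₁ * L₂ * K / (H₁ * H₂ * r ^ 2) ≠ 0 := by
    positivity
  generalize Λ ^ 2 * L₁ * L₂ * K / (H₁ * H₂ * r ^ 2) = M at *
  have s₂ : K * M * (X / M * ((r ^ 2)⁻¹ * F₂)) = K * (X * ((r ^ 2)⁻¹ * F₂)) := by field_simp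
  have s₃ : r ^ 2 * (r ^ 2)⁻¹ = 1 := mul_inv_cancel₀ (pow_ne_zero 2 hr)
  simp only [div_eq_mul_inv _ (r ^ 2)] at *
  linear_combination (X * (r ^ 2)⁻¹ * F₁) * a₁ + (X * (r ^ 2)⁻¹ * F₂) * a₂
    - (X * (r ^ 2)⁻¹ * F₃) * a₃
    + (x - L₁ / r * t₁) * (x - L₂ / r * t₂) * s₂
    + K * (L₁ * L₂ * t₁ * t₂ * (r ^ 2)⁻¹) * X * (r ^ 2)⁻¹ * hF
    - K * (L₁ * L₂ * t₁ * t₂ * (r ^ 2)⁻¹) * X * x * (1 - Λ) * s₃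

/-- The prefactor is $x^{1-k_2}q^{-\lambda}=x^{-k_2}q^{-1}\cdot(qx/q^\lambda)$, whose last factor is
the first node of the sum. -/
theorem gZero_eq (hq : ‖P.q‖ < 1) {S : Set ℂ} {ℓ : ℂ → ℂ}
    (hℓ : P.IsLogBranch S ℓ) {x : ℂ} (hx : x ∈ S) (hr : x ∈ P.regZero) :
    ∃ F, HasSum (fun n : ℕ => kernel P.q (P.qpow P.lam) (P.α P.l₁ P.t₁) (P.α P.l₂ P.t₂)
        (P.β P.h₁ P.t₁) (P.β P.h₂ P.t₂) (P.q ^ n * (P.q * x / P.qpow P.lam)) x) F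
      ∧ P.gZero ℓ x = Complex.exp (-P.k₂ * ℓ x) * (P.q⁻¹ * F) := by
  obtain ⟨hx0, h₁, h₂, h₃, h₄, h₅⟩ := hr
  have hΛ := P.qpow_ne_zero P.lam
  have hq0 := P.q_ne_zero
  have hr := P.qpow_ne_zero (1 / 2)
  have eβ : ∀ h t, P.qpow (-h + 1 / 2) * x / t = P.β h t * (P.q * x / P.qpow P.lam) :=
    fun h t => by
      have := P.qpow_ne_zero h
      rw [β, qpow_add, qpow_neg, q_eq_sq]
      simp only [div_eq_mul_inv, mul_inv]; field_simp
  have eα : ∀ l t, P.qpow (-P.lam - l + 3 / 2) * x / t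
      = P.α l t * (P.q * x / P.qpow P.lam) := fun l t => by
    rw [α, qpow_add, qpow_sub, qpow_neg, q_eq_sq, qpow_three_halves]
    simp only [div_eq_mul_inv, mul_inv]; ring
  have eΛ : P.qpow (1 - P.lam) = P.q / P.qpow P.lam := by rw [qpow_sub, qpow_one]
  rw [eβ] at h₁ h₂
  rw [eα] at h₄ h₅
  rw [eΛ] at h₃
  refine ⟨_, hasSum_kernel_of_ne hq hx0 hΛ h₁ h₂ h₃ h₄ h₅, ?_⟩
  have ex : Complex.exp ((1 - P.k₂) * ℓ x) = Complex.exp (-P.k₂ * ℓ x) * x := by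
    rw [sub_mul, one_mul, Complex.exp_sub, hℓ.exp_log x hx, neg_mul, Complex.exp_neg]
    ring
  rw [gZero, eβ, eβ, eα, eα, eΛ, ex, qpow_neg]
  field_simp

theorem gOne_eq (hq : ‖P.q‖ < 1) (ht₁ : P.t₁ ≠ 0) (ℓ : ℂ → ℂ) {x : ℂ} (hr : x ∈ P.regOne) :
    ∃ F, HasSum (fun n : ℕ => kernel P.q (P.qpow P.lam) (P.α P.l₁ P.t₁) (P.α P.l₂ P.t₂)
        (P.β P.h₁ P.t₁) (P.β P.h₂ P.t₂) (P.q ^ n * (P.q / P.α P.l₁ P.t₁)) x) F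
      ∧ P.gOne ℓ x = Complex.exp (-P.k₂ * ℓ x) * (P.q⁻¹ * F) := by
  obtain ⟨hx0, h₁, h₂, h₃, h₄, h₅⟩ := hr
  have hq0 := P.q_ne_zero
  have hr := P.qpow_ne_zero (1 / 2)
  have hL := P.qpow_ne_zero P.l₁
  have hα : P.α P.l₁ P.t₁ ≠ 0 := div_ne_zero hr (mul_ne_zero hL ht₁)
  have e₀ : P.q / P.α P.l₁ P.t₁ = P.qpow (P.l₁ + 1 / 2) * P.t₁ := by
    rw [α, qpow_add, q_eq_sq]; field_simp
  have eβ₁ : P.qpow (P.lam - P.h₁ + P.l₁) = P.β P.h₁ P.t₁ * (P.q / P.α P.l₁ P.t₁) := by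
    have := P.qpow_ne_zero P.h₁
    rw [e₀, β, qpow_add, qpow_add, qpow_sub]; field_simp
  have eβ₂ : P.qpow (P.lam - P.h₂ + P.l₁) * P.t₁ / P.t₂
      = P.β P.h₂ P.t₂ * (P.q / P.α P.l₁ P.t₁) := by
    have := P.qpow_ne_zero P.h₂
    rw [e₀, β, qpow_add, qpow_add, qpow_sub]
    simp only [div_eq_mul_inv, mul_inv]; field_simp
  have eΛ : P.qpow (P.lam + P.l₁ + 1 / 2) * P.t₁ / x
      = P.qpow P.lam * (P.q / P.α P.l₁ P.t₁) / x := by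
    rw [e₀, add_assoc, qpow_add, mul_assoc]
  have eα : P.qpow (P.l₁ - P.l₂ + 1) * P.t₁ / P.t₂
      = P.α P.l₂ P.t₂ * (P.q / P.α P.l₁ P.t₁) := by
    rw [e₀, α, qpow_add, qpow_add, qpow_sub, qpow_one, q_eq_sq]
    simp only [div_eq_mul_inv, mul_inv]; ring
  -- The constant in front of $g_1$ is likewise $q^{-1}$ times the first node.
  have e₁ : P.qpow (P.l₁ - 1 / 2) * P.t₁ = P.q⁻¹ * (P.q / P.α P.l₁ P.t₁) := by
    rw [e₀, qpow_add, qpow_sub, q_eq_sq]; field_simp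
  rw [← e₀] at h₁
  rw [eβ₁] at h₂
  rw [eβ₂] at h₃
  rw [eΛ] at h₄
  rw [eα] at h₅
  refine ⟨_, hasSum_kernel_of_root hq hα h₁ h₂ h₃ h₄ h₅, ?_⟩
  rw [gOne, eβ₁, eβ₂, eΛ, eα, ← e₀, mul_assoc (Complex.exp _), e₁]
  ring

/-! ### The common inhomogeneous equation -/

theorem operator_gZero (hq : ‖P.q‖ < 1) (ht₁ : P.t₁ ≠ 0) (ht₂ : P.t₂ ≠ 0) {S : Set ℂ}
    {ℓ : ℂ → ℂ} (hℓ : P.IsLogBranch S ℓ) {x : ℂ} (hx : x ∈ S) (h₁ : x / P.q ∈ P.regZero)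
    (h₂ : P.q * x ∈ P.regZero) (h₃ : x ∈ P.regZero) :
    P.operator (P.gZero ℓ) x = P.inhomogeneity ℓ x := by
  obtain ⟨F₁, s₁, e₁⟩ := P.gZero_eq hq hℓ (hℓ.div_mem x hx) h₁
  obtain ⟨F₂, s₂, e₂⟩ := P.gZero_eq hq hℓ (hℓ.mul_mem x hx) h₂
  obtain ⟨F₃, s₃, e₃⟩ := P.gZero_eq hq hℓ hx h₃
  have hΛ := P.qpow_ne_zero P.lam
  have hq0 := P.q_ne_zero
  have hr := P.qpow_ne_zero (1 / 2)
  have eβ : ∀ h t, P.qpow (-h + 1 / 2) * (x / P.q) / t = P.β h t * (x / P.qpow P.lam) :=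
    fun h t => by
      have := P.qpow_ne_zero h
      rw [β, qpow_add, qpow_neg, q_eq_sq]
      simp only [div_eq_mul_inv, mul_inv]; field_simp
  refine P.operator_eq_inhomogeneity ht₁ ht₂ hℓ hx e₁ e₂ e₃
    (hasSum_kernel_diagonal hq hq0 h₃.1 hΛ ?_ ?_ ?_ s₁ s₂ s₃)
  -- The sum at $x/q$ starts earliest, at $x/q^\lambda$, so the conditions there suffice.
  · rw [← eβ]; exact h₁.2.1
  · rw [← eβ]; exact h₁.2.2.1
  · simpa only [qpow_sub, qpow_one] using h₁.2.2.2.1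

theorem operator_gOne (hq : ‖P.q‖ < 1) (ht₁ : P.t₁ ≠ 0) (ht₂ : P.t₂ ≠ 0) {S : Set ℂ}
    {ℓ : ℂ → ℂ} (hℓ : P.IsLogBranch S ℓ) {x : ℂ} (hx : x ∈ S) (h₁ : x / P.q ∈ P.regOne)
    (h₂ : P.q * x ∈ P.regOne) (h₃ : x ∈ P.regOne) :
    P.operator (P.gOne ℓ) x = P.inhomogeneity ℓ x := by
  obtain ⟨F₁, s₁, e₁⟩ := P.gOne_eq hq ht₁ ℓ h₁
  obtain ⟨F₂, s₂, e₂⟩ := P.gOne_eq hq ht₁ ℓ h₂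
  obtain ⟨F₃, s₃, e₃⟩ := P.gOne_eq hq ht₁ ℓ h₃
  have hr := P.qpow_ne_zero (1 / 2)
  have hL := P.qpow_ne_zero P.l₁
  have hα : P.α P.l₁ P.t₁ ≠ 0 := div_ne_zero hr (mul_ne_zero hL ht₁)
  have e₀ : P.q / P.α P.l₁ P.t₁ = P.qpow (P.l₁ + 1 / 2) * P.t₁ := by
    rw [α, qpow_add, q_eq_sq]; field_simp
  refine P.operator_eq_inhomogeneity ht₁ ht₂ hℓ hx e₁ e₂ e₃
    (hasSum_kernel_root hq P.q_ne_zero h₃.1 hα ?_ ?_ ?_ s₁ s₂ s₃)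
  · convert h₃.2.2.1 using 1
    have := P.qpow_ne_zero P.h₁
    rw [e₀, β, qpow_add, qpow_add, qpow_sub]; field_simp
  · convert h₃.2.2.2.1 using 1
    have := P.qpow_ne_zero P.h₂
    rw [e₀, β, qpow_add, qpow_add, qpow_sub]
    simp only [div_eq_mul_inv, mul_inv]; field_simp
  -- The symbol $(s/(qx);q)_\infty$ in `primitive` is the kernel denominator at the point $qx$.
  · rw [e₀]; exact h₂.2.1

theorem lam_swap : P.swap.lam = P.lam := by
  simp only [lam, swap]; ring

theorem p_swap : P.swap.p = P.p := by
  simp only [p, swap, qpow]; ring_nf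

theorem E_swap : P.swap.E = P.E := by
  rw [E, E, p_swap]; simp only [swap, qpow]; ring

theorem operator_swap (g : ℂ → ℂ) (x : ℂ) : P.swap.operator g x = P.operator g x := by
  rw [operator, operator, p_swap, E_swap]; simp only [swap, qpow, q]; ring

theorem inhomogeneity_swap (ℓ : ℂ → ℂ) (x : ℂ) :
    P.swap.inhomogeneity ℓ x = P.inhomogeneity ℓ x := by
  rw [inhomogeneity, inhomogeneity, lam_swap]; simp only [swap, qpow, q]; ring

theorem operator_g (hq : ‖P.q‖ < 1) (ht₁ : P.t₁ ≠ 0) (ht₂ : P.t₂ ≠ 0) {S : Set ℂ}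
    {ℓ : ℂ → ℂ} (hℓ : P.IsLogBranch S ℓ) (i : Fin 3) {x : ℂ} (hx : x ∈ S)
    (h₁ : x / P.q ∈ P.reg i) (h₂ : P.q * x ∈ P.reg i) (h₃ : x ∈ P.reg i) :
    P.operator (P.g ℓ i) x = P.inhomogeneity ℓ x := by
  fin_cases i
  · exact P.operator_gZero hq ht₁ ht₂ hℓ hx h₁ h₂ h₃
  · exact P.operator_gOne hq ht₁ ht₂ hℓ hx h₁ h₂ h₃
  -- Equation and right-hand side are symmetric in the indices $1,2$, so the case of $g_2$ is that
  -- of $g_1$ for the swapped parameters.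
  · rw [← operator_swap, ← inhomogeneity_swap]
    have hℓ' : P.swap.IsLogBranch S ℓ := ⟨hℓ.mul_mem, hℓ.div_mem, hℓ.exp_log, hℓ.log_mul⟩
    exact P.swap.operator_gOne hq ht₂ ht₁ hℓ' hx h₁ h₂ h₃

end Param

end QHypergeometric

theorem corollary4p7 (P : QHypergeometric.Param) (hq : ‖P.q‖ < 1)
    (ht₁ : P.t₁ ≠ 0) (ht₂ : P.t₂ ≠ 0)
    (S : Set ℂ) (ℓ : ℂ → ℂ) (hℓ : P.IsLogBranch S ℓ) (i j : Fin 3) :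
    P.IsSolutionOn (fun x => P.g ℓ i x - P.g ℓ j x) (S ∩ P.reg i ∩ P.reg j) := by
  intro x h₁ h₃ h₂
  have hi := P.operator_g hq ht₁ ht₂ hℓ i h₃.1.1 h₁.1.2 h₂.1.2 h₃.1.2
  have hj := P.operator_g hq ht₁ ht₂ hℓ j h₃.1.1 h₁.2 h₂.2 h₃.2
  rw [QHypergeometric.Param.operator] at hi hj
  linear_combination hi - hj
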